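/- Let $\mathbb K=\mathbb R$ or $\mathbb C$. For $0<p\le\infty$ and a finite sequence $(x_j)_{j=1}^m$ in a Banach space $E$ over $\mathbb K$ put $\|(x_j)\|_p=\big(\sum_j\|x_j\|^p\big)^{1/p}$ ($\max_j\|x_j\|$ if $p=\infty$) and $\|(x_j)\|_{p}^{w}=\sup_{\varphi\in B_{E'}}\|(\varphi(x_j))_j\|_p$. Let $0<p,p_1,\dots,p_n\le\infty$ with $\frac1p\le\frac1{p_1}+\dots+\frac1{p_n}$ (where $\frac1\infty=0$). A continuous $n$-linear mapping $A\colon E_1\times\dots\times E_n\to F$ between Banach spaces is absolutely $(p;p_1,\dots,p_n)$-summing if there is $C>0$ such that $$\|(A(x_j^1,\dots,x_j^n))_{j=1}^m\|_p\le C\prod_{i=1}^n\|(x^i_j)_{j=1}^m\|_{p_i}^{w}$$ for all $m$ and all $x_j^i\in E_i$. The space of all such $A$ is denoted by $\Pi_{(p;p_1,\dots,p_n)}(E_1,\dots,E_n;F)$ and is endowed with the (quasi-)norm $\pi_{(p;p_1,\dots,p_n)}(A)$, the infimum of these $C$. A Banach space $E$ has cotype $2$ if there is $C>0$ with $\big(\sum_{j=1}^m\|x_j\|^2\big)^{1/2}\le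 C\big(2^{-m}\sum_{\varepsilon\in\{-1,1\}^m}\|\sum_{j=1}^m\varepsilon_jx_j\|^2\big)^{1/2}$ for all finite sequences in $E$. **Theorem.** Let $1\le k\le n$, let $E_1,\dots,E_n$ be Banach spaces over $\mathbb K$ and assume that $E_1,\dots,E_k$ have cotype $2$. Let $0<p\le q\le\infty$, $0<p_{k+1},\dots,p_n\le\infty$ and $1\le q_i\le2$ for $i=1,\dots,k$, with $\frac1p\le k+\sum_{i=k+1}^n\frac1{p_i}$ and $$\sum_{i=1}^k\frac1{q_i}-\frac1q=k-\frac1p.$$ Then, for every Banach space $F$ over $\mathbb K$, $$\Pi_{(p;1,\dots,1,p_{k+1},\dots,p_n)}(E_1,\dots,E_n;F)=\Pi_{(q;q_1,\dots,q_k,p_{k+1},\dots,p_n)}(E_1,\dots,E_n;F),$$ with $1$ repeated $k$ times on the left; that is, both spaces consist of the same mappings, and their (quasi-)norms are equivalent. -/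

import Mathlib

open scoped ENNReal

noncomputable section

/-- The norm of a finite sequence in `ℓ_p(E)`, `0 < p ≤ ∞`: it is `(∑ j, ‖x j‖ ^ p) ^ (1 / p)`
if `p < ∞` (a quasi-norm if `p < 1`), and `sup j, ‖x j‖` if `p = ∞`. -/
def strongNorm {E : Type*} [NormedAddCommGroup E] (p : ℝ≥0∞) {m : ℕ} (x : Fin m → E) : ℝ :=
  ‖(WithLp.toLp p x : PiLp p (fun _ : Fin m => E))‖

/-- The norm of a finite sequence in `ℓ_p^w(E)`, `0 < p ≤ ∞`: the supremum of the `ℓ_p` norm of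
`(φ (x j))_j` over the closed unit ball of the dual space. (For a finite sequence it is a supremum
of a nonempty bounded set of real numbers.) -/
def weakNorm (𝕜 : Type*) [RCLike 𝕜] {E : Type*} [NormedAddCommGroup E] [NormedSpace 𝕜 E]
    (p : ℝ≥0∞) {m : ℕ} (x : Fin m → E) : ℝ :=
  ⨆ φ : Metric.closedBall (0 : StrongDual 𝕜 E) 1, strongNorm p (fun j => φ.1 (x j))

/-- `C` is an admissible constant in the definition of absolutely
`(p; p_1, …, p_n)`-summing multilinear mappings. -/
def IsSummingBound {𝕜 : Type*} [RCLike 𝕜] {n : ℕ} {E : Fin n → Type*}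
    [∀ i, NormedAddCommGroup (E i)] [∀ i, NormedSpace 𝕜 (E i)]
    {F : Type*} [NormedAddCommGroup F] [NormedSpace 𝕜 F]
    (p : ℝ≥0∞) (ps : Fin n → ℝ≥0∞) (A : ContinuousMultilinearMap 𝕜 E F) (C : ℝ) : Prop :=
  ∀ (m : ℕ) (x : ∀ i, Fin m → E i),
    strongNorm p (fun j => A (fun i => x i j)) ≤ C * ∏ i, weakNorm 𝕜 (ps i) (x i)

/-- `Π_{(p; p_1, …, p_n)}(E_1, …, E_n; F)`: the absolutely `(p; p_1, …, p_n)`-summing continuous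
`n`-linear mappings. -/
def summingMaps (𝕜 : Type*) [RCLike 𝕜] {n : ℕ} (E : Fin n → Type*)
    [∀ i, NormedAddCommGroup (E i)] [∀ i, NormedSpace 𝕜 (E i)]
    (F : Type*) [NormedAddCommGroup F] [NormedSpace 𝕜 F]
    (p : ℝ≥0∞) (ps : Fin n → ℝ≥0∞) : Set (ContinuousMultilinearMap 𝕜 E F) :=
  {A | ∃ C : ℝ, 0 < C ∧ IsSummingBound p ps A C}

/-- The summing norm `π_{(p; p_1, …, p_n)}(A)`. -/
def summingNorm {𝕜 : Type*} [RCLike 𝕜] {n : ℕ} {E : Fin n → Type*}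
    [∀ i, NormedAddCommGroup (E i)] [∀ i, NormedSpace 𝕜 (E i)]
    {F : Type*} [NormedAddCommGroup F] [NormedSpace 𝕜 F]
    (p : ℝ≥0∞) (ps : Fin n → ℝ≥0∞) (A : ContinuousMultilinearMap 𝕜 E F) : ℝ :=
  sInf {C : ℝ | 0 < C ∧ IsSummingBound p ps A C}

/-- The Rademacher average `(𝔼 ‖∑ j, ε j • x j‖ ^ 2) ^ (1 / 2)`, the `ε j` being independent
uniformly distributed signs; the expectation is the mean over the `2 ^ m` choices of signs. It is
the norm of `∑ j, r_j x_j` in `L²([0,1], E)`, where `r_j` are the Rademacher functions. -/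
def rademacherAverage {E : Type*} [NormedAddCommGroup E] {m : ℕ} (x : Fin m → E) : ℝ :=
  Real.sqrt ((∑ ε : Fin m → ℤˣ, ‖∑ j, ε j • x j‖ ^ 2) / 2 ^ m)

/-- `E` has cotype `2`. -/
def HasCotypeTwo (E : Type*) [NormedAddCommGroup E] : Prop :=
  ∃ C : ℝ, 0 < C ∧ ∀ (m : ℕ) (x : Fin m → E),
    Real.sqrt (∑ j, ‖x j‖ ^ 2) ≤ C * rademacherAverage x

end

/-!
Both inclusions rest on Hölder's inequality in the form: if `w i` are subprobability vectors and
`1 / p = 1 / q + ∑ i, s i`, then multiplication by `∏ i, (w i) ^ (s i)` maps `ℓ_q` into `ℓ_p` with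
norm at most one (`strongNorm_le_of_weights`). It is used with `s i = 1 - 1 / q_i` for `i ≤ k` and
`s i = 0` for the remaining indices; the hypothesis on the exponents says exactly that
`1 / p = 1 / q + ∑ i, s i`.

From `(p; 1, …, 1, …)` to `(q; q_1, …, q_k, …)` (`IsSummingBound.of_le`) no geometry is needed.
One applies the first bound to the sequences `w ^ (s i) x^i`, where `w j` is proportional to
`‖A (x_j^1, …, x_j^n)‖ ^ q` if `q < ∞`, and `w` runs through the unit vectors if `q = ∞`.

For the converse (`IsSummingBound.of_factorization`), every weakly summable sequence in a space of
cotype two has to be written as `w ^ (1 - 1 / r)` times a weakly `r`-summable sequence, `1 ≤ r ≤ 2`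
(`HasCotypeTwo.exists_factorization`). By Hölder's inequality it is enough to do so for `r = 2`, with
the same `w`, and by duality (`weakNorm_two_le_of_dominated`) this means that the operator
`u : e_j ↦ x_j` on the finite-dimensional `ℓ_∞` satisfies `‖u a‖ ≤ κ ‖a‖_{L_2(w)}` with `κ` at most a
constant times `‖u‖`. Such a `κ` is found by extrapolation. Some `κ` exists, as the space is
finite-dimensional. Truncation of `a` interpolates between the `L_2(w)` bound and the sup norm bound
and gives an `L_4(w)` bound with constant of order `√(κ ‖u‖)` (`norm_sq_le_of_truncation`). Cotype two
and Khinchin's inequality for the fourth moment turn the latter into a `2`-summing inequality with a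
constant of the same order (`two_summing_of_dominated`), and Pietsch domination
(`exists_prob_of_two_summing`, a separation argument in `ℝ ^ m`) leads back to an `L_2` bound for
another probability vector. Thus `κ` may be replaced by a multiple of `√(κ ‖u‖)`, and hence the
infimum of the admissible `κ` is at most a multiple of `‖u‖`.
-/

/-! ### Sequence norms and Hölder's inequality -/

section SequenceNorms

variable {G H : Type*} [NormedAddCommGroup G] [NormedAddCommGroup H] {m : ℕ}

lemma strongNorm_eq_sum {p : ℝ≥0∞} (hp : 0 < p) (hp' : p ≠ ⊤) (x : Fin m → G) :
    strongNorm p x = (∑ j, ‖x j‖ ^ p.toReal) ^ (1 / p.toReal) :=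
  PiLp.norm_eq_sum (ENNReal.toReal_pos hp.ne' hp') _

lemma strongNorm_top (x : Fin m → G) : strongNorm ⊤ x = ⨆ j, ‖x j‖ :=
  PiLp.norm_eq_ciSup _

lemma strongNorm_nonneg {p : ℝ≥0∞} (hp : 0 < p) (x : Fin m → G) : 0 ≤ strongNorm p x := by
  by_cases hp' : p = ⊤
  · subst hp'
    rw [strongNorm_top]
    exact Real.iSup_nonneg fun _ => norm_nonneg _
  · rw [strongNorm_eq_sum hp hp']
    positivity

lemma strongNorm_rpow {p : ℝ≥0∞} (hp : 0 < p) (hp' : p ≠ ⊤) (x : Fin m → G) :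
    strongNorm p x ^ p.toReal = ∑ j, ‖x j‖ ^ p.toReal := by
  have := ENNReal.toReal_pos hp.ne' hp'
  rw [strongNorm_eq_sum hp hp', ← Real.rpow_mul (by positivity), one_div,
    inv_mul_cancel₀ this.ne', Real.rpow_one]

lemma strongNorm_two_sq (x : Fin m → G) : strongNorm 2 x ^ 2 = ∑ j, ‖x j‖ ^ 2 := by
  have := strongNorm_rpow (p := 2) (by norm_num) (by norm_num) x
  simpa using this

lemma strongNorm_one (x : Fin m → G) : strongNorm 1 x = ∑ j, ‖x j‖ := by
  simpa using strongNorm_eq_sum (p := 1) (by norm_num) (by norm_num) x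

lemma strongNorm_le_of_sum_le {p : ℝ≥0∞} (hp : 0 < p) (hp' : p ≠ ⊤) {x : Fin m → G} {N : ℝ}
    (hN : 0 ≤ N) (h : ∑ j, ‖x j‖ ^ p.toReal ≤ N ^ p.toReal) : strongNorm p x ≤ N := by
  rw [← strongNorm_rpow hp hp'] at h
  exact (Real.rpow_le_rpow_iff (strongNorm_nonneg hp x) hN (ENNReal.toReal_pos hp.ne' hp')).1 h

lemma strongNorm_mono {p : ℝ≥0∞} (hp : 0 < p) {x : Fin m → G} {y : Fin m → H}
    (h : ∀ j, ‖x j‖ ≤ ‖y j‖) : strongNorm p x ≤ strongNorm p y := by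
  by_cases hp' : p = ⊤
  · subst hp'
    rw [strongNorm_top, strongNorm_top]
    exact ciSup_mono (Set.finite_range _).bddAbove h
  · refine strongNorm_le_of_sum_le hp hp' (strongNorm_nonneg hp _) ?_
    rw [strongNorm_rpow hp hp']
    exact Finset.sum_le_sum fun j _ => Real.rpow_le_rpow (norm_nonneg _) (h j) ENNReal.toReal_nonneg

lemma norm_le_strongNorm {p : ℝ≥0∞} (hp : 0 < p) (x : Fin m → G) (j : Fin m) :
    ‖x j‖ ≤ strongNorm p x := by
  by_cases hp' : p = ⊤
  · subst hp'
    rw [strongNorm_top]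
    exact le_ciSup (f := fun j => ‖x j‖) (Set.finite_range _).bddAbove j
  · refine (Real.rpow_le_rpow_iff (norm_nonneg _) (strongNorm_nonneg hp x)
      (ENNReal.toReal_pos hp.ne' hp')).1 ?_
    rw [strongNorm_rpow hp hp']
    exact Finset.single_le_sum (f := fun j => ‖x j‖ ^ p.toReal)
      (fun _ _ => by positivity) (Finset.mem_univ j)

lemma strongNorm_top_le {x : Fin m → G} {N : ℝ} (hN : 0 ≤ N) (h : ∀ j, ‖x j‖ ≤ N) :
    strongNorm ⊤ x ≤ N := by
  rw [strongNorm_top]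
  exact Real.iSup_le h hN

/-- A sequence with finite `ℓ_q` norm `N` is, up to the factor `N`, the power `1 / q` of a
subprobability vector; for `q = ∞` the power is `0`. -/
lemma exists_weight_of_strongNorm {q : ℝ≥0∞} (hq : 0 < q) (b : Fin m → G) :
    ∃ v : Fin m → ℝ, (∀ j, 0 ≤ v j) ∧ (∑ j, v j ≤ 1) ∧
      ∀ j, ‖b j‖ ≤ strongNorm q b * v j ^ (q⁻¹).toReal := by
  by_cases hq' : q = ⊤
  · subst hq'
    exact ⟨0, by simp, by simp, fun j => by simpa using norm_le_strongNorm hq b j⟩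
  have hQ := ENNReal.toReal_pos hq.ne' hq'
  rcases (strongNorm_nonneg hq b).eq_or_lt with h0 | hN
  · refine ⟨0, by simp, by simp, fun j => ?_⟩
    have := norm_le_strongNorm hq b j
    rw [← h0] at this ⊢
    simpa using this
  · refine ⟨fun j => (‖b j‖ / strongNorm q b) ^ q.toReal, fun j => by positivity, ?_, fun j => ?_⟩
    · simp_rw [Real.div_rpow (norm_nonneg _) hN.le, ← Finset.sum_div, ← strongNorm_rpow hq hq']
      exact div_self_le_one _
    · rw [ENNReal.toReal_inv, ← Real.rpow_mul (by positivity), mul_inv_cancel₀ hQ.ne',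
        Real.rpow_one, mul_div_cancel₀ _ hN.ne']

/-- Hölder's inequality: multiplication by the powers `s i` of subprobability vectors maps
`ℓ_q` into `ℓ_p` with norm at most one, when `1 / p = 1 / q + ∑ i, s i`. -/
lemma strongNorm_le_of_weights {ι : Type*} [Fintype ι] {p q : ℝ≥0∞} (hp : 0 < p) (hpq : p ≤ q)
    {s : ι → ℝ} (hs : ∀ i, 0 ≤ s i) (h : (p⁻¹).toReal = (q⁻¹).toReal + ∑ i, s i)
    {w : ι → Fin m → ℝ} (hw : ∀ i j, 0 ≤ w i j) (hw1 : ∀ i, ∑ j, w i j ≤ 1)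
    {a : Fin m → G} {b : Fin m → H} (hab : ∀ j, ‖a j‖ ≤ (∏ i, w i j ^ s i) * ‖b j‖) :
    strongNorm p a ≤ strongNorm q b := by
  have hq : 0 < q := hp.trans_le hpq
  have hN := strongNorm_nonneg hq b
  by_cases hp' : p = ⊤
  · subst hp'
    have hq' : q = ⊤ := top_le_iff.1 hpq
    subst hq'
    have hs0 : ∀ i, s i = 0 := by
      have h0 : ∑ i, s i = 0 := by simpa using h.symm
      exact fun i => (Finset.sum_eq_zero_iff_of_nonneg fun i _ => hs i).1 h0 i (Finset.mem_univ i)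
    exact strongNorm_mono hp fun j => by simpa [hs0] using hab j
  obtain ⟨v, hv, hv1, hbv⟩ := exists_weight_of_strongNorm hq b
  have hP := ENNReal.toReal_pos hp.ne' hp'
  have ht : 0 ≤ (q⁻¹).toReal := ENNReal.toReal_nonneg
  refine strongNorm_le_of_sum_le hp hp' hN ?_
  have hsum : p.toReal * (q⁻¹).toReal + ∑ i, p.toReal * s i = 1 := by
    rw [← Finset.mul_sum, ← mul_add, ← h, ENNReal.toReal_inv, mul_inv_cancel₀ hP.ne']
  have key : ∀ j, ‖a j‖ ^ p.toReal ≤ strongNorm q b ^ p.toReal *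
      (p.toReal * (q⁻¹).toReal * v j + ∑ i, p.toReal * s i * w i j) := by
    intro j
    have hprod : 0 ≤ ∏ i, w i j ^ s i := Finset.prod_nonneg fun i _ => Real.rpow_nonneg (hw i j) _
    -- Weighted arithmetic-geometric mean inequality over the weights `w i j` together with `v j`.
    have amgm := Real.geom_mean_le_arith_mean_weighted (Finset.univ : Finset (Option ι))
      (fun o => o.elim (p.toReal * (q⁻¹).toReal) fun i => p.toReal * s i)
      (fun o => o.elim (v j) fun i => w i j)
      (by rintro (_ | i) - <;> simp only [Option.elim]
          · positivity
          · exact mul_nonneg hP.le (hs i))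
      (by simpa [Fintype.sum_option] using hsum)
      (by rintro (_ | i) - <;> simp only [Option.elim]
          · exact hv j
          · exact hw i j)
    simp only [Fintype.prod_option, Fintype.sum_option, Option.elim] at amgm
    calc ‖a j‖ ^ p.toReal
        ≤ (strongNorm q b * (v j ^ (q⁻¹).toReal * ∏ i, w i j ^ s i)) ^ p.toReal := by
          refine Real.rpow_le_rpow (norm_nonneg _) ((hab j).trans ?_) hP.le
          calc (∏ i, w i j ^ s i) * ‖b j‖
              ≤ (∏ i, w i j ^ s i) * (strongNorm q b * v j ^ (q⁻¹).toReal) :=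
                mul_le_mul_of_nonneg_left (hbv j) hprod
            _ = _ := by ring
      _ = strongNorm q b ^ p.toReal * (v j ^ (p.toReal * (q⁻¹).toReal) *
            ∏ i, w i j ^ (p.toReal * s i)) := by
          rw [Real.mul_rpow hN (mul_nonneg (Real.rpow_nonneg (hv j) _) hprod),
            Real.mul_rpow (Real.rpow_nonneg (hv j) _) hprod, ← Real.rpow_mul (hv j),
            ← Real.finsetProd_rpow _ _ fun i _ => Real.rpow_nonneg (hw i j) _]
          simp_rw [← Real.rpow_mul (hw _ j), mul_comm p.toReal]
      _ ≤ _ := mul_le_mul_of_nonneg_left amgm (by positivity)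
  calc ∑ j, ‖a j‖ ^ p.toReal
      ≤ ∑ j, strongNorm q b ^ p.toReal *
        (p.toReal * (q⁻¹).toReal * v j + ∑ i, p.toReal * s i * w i j) :=
        Finset.sum_le_sum fun j _ => key j
    _ = strongNorm q b ^ p.toReal * (p.toReal * (q⁻¹).toReal * ∑ j, v j +
        ∑ i, p.toReal * s i * ∑ j, w i j) := by
        rw [← Finset.mul_sum, Finset.sum_add_distrib, Finset.sum_comm]
        simp_rw [Finset.mul_sum]
    _ ≤ strongNorm q b ^ p.toReal * (p.toReal * (q⁻¹).toReal * 1 + ∑ i, p.toReal * s i * 1) := by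
        refine mul_le_mul_of_nonneg_left (add_le_add ?_ (Finset.sum_le_sum fun i _ => ?_))
          (by positivity)
        · exact mul_le_mul_of_nonneg_left hv1 (by positivity)
        · exact mul_le_mul_of_nonneg_left (hw1 i) (mul_nonneg hP.le (hs i))
    _ = strongNorm q b ^ p.toReal := by simp only [mul_one, hsum]

variable {𝕜 : Type*} [RCLike 𝕜] [NormedSpace 𝕜 G]

lemma strongNorm_apply_le_weakNorm {p : ℝ≥0∞} (hp : 0 < p) (x : Fin m → G)
    {φ : StrongDual 𝕜 G} (hφ : ‖φ‖ ≤ 1) : strongNorm p (fun j => φ (x j)) ≤ weakNorm 𝕜 p x := by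
  refine le_ciSup (f := fun φ : Metric.closedBall (0 : StrongDual 𝕜 G) 1 =>
    strongNorm p (fun j => φ.1 (x j))) ⟨strongNorm p x, ?_⟩ ⟨φ, by simpa using hφ⟩
  rintro _ ⟨ψ, rfl⟩
  refine strongNorm_mono hp fun j => (ψ.1.le_of_opNorm_le ?_ _).trans_eq (one_mul _)
  exact mem_closedBall_zero_iff.1 ψ.2

lemma weakNorm_le {p : ℝ≥0∞} {x : Fin m → G} {N : ℝ}
    (h : ∀ φ : StrongDual 𝕜 G, ‖φ‖ ≤ 1 → strongNorm p (fun j => φ (x j)) ≤ N) :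
    weakNorm 𝕜 p x ≤ N := by
  have : Nonempty (Metric.closedBall (0 : StrongDual 𝕜 G) 1) := ⟨⟨0, by simp⟩⟩
  exact ciSup_le fun φ => h φ.1 (mem_closedBall_zero_iff.1 φ.2)

lemma weakNorm_nonneg {p : ℝ≥0∞} (hp : 0 < p) (x : Fin m → G) : 0 ≤ weakNorm 𝕜 p x :=
  (strongNorm_nonneg hp _).trans
    (strongNorm_apply_le_weakNorm hp x (φ := (0 : StrongDual 𝕜 G)) (by simp))

/-- Hölder's inequality for weak norms. -/
lemma weakNorm_rpow_smul_le {p q : ℝ≥0∞} (hp : 0 < p) (hpq : p ≤ q) {s : ℝ} (hs : 0 ≤ s)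
    (h : (p⁻¹).toReal = (q⁻¹).toReal + s) {w : Fin m → ℝ} (hw : ∀ j, 0 ≤ w j)
    (hw1 : ∑ j, w j ≤ 1) (x : Fin m → G) :
    weakNorm 𝕜 p (fun j => ((w j ^ s : ℝ) : 𝕜) • x j) ≤ weakNorm 𝕜 q x := by
  refine weakNorm_le fun φ hφ =>
    le_trans ?_ (strongNorm_apply_le_weakNorm (hp.trans_le hpq) x hφ)
  refine strongNorm_le_of_weights (ι := Unit) hp hpq (s := fun _ => s) (w := fun _ => w)
    (fun _ => hs) (by simpa using h) (fun _ => hw) (fun _ => hw1) fun j => ?_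
  simp [abs_of_nonneg (Real.rpow_nonneg (hw j) s)]

/-- The weak `ℓ_1` norm controls all combinations with coefficients bounded by one, by the
Hahn–Banach theorem. -/
lemma norm_sum_smul_le_weakNorm_one (x : Fin m → G) {a : Fin m → 𝕜} {T : ℝ}
    (ha : ∀ j, ‖a j‖ ≤ T) :
    ‖∑ j, a j • x j‖ ≤ weakNorm 𝕜 1 x * T := by
  obtain ⟨φ, hφ, h⟩ := exists_dual_vector'' 𝕜 (∑ j, a j • x j)
  calc ‖∑ j, a j • x j‖ = ‖φ (∑ j, a j • x j)‖ := by rw [h]; simp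
    _ ≤ ∑ j, ‖a j * φ (x j)‖ := by
        rw [map_sum]
        simpa using norm_sum_le Finset.univ fun j => φ (a j • x j)
    _ ≤ ∑ j, T * ‖φ (x j)‖ := Finset.sum_le_sum fun j _ => by
        rw [norm_mul]
        exact mul_le_mul_of_nonneg_right (ha j) (norm_nonneg _)
    _ = T * strongNorm 1 (fun j => φ (x j)) := by rw [strongNorm_one, Finset.mul_sum]
    _ ≤ weakNorm 𝕜 1 x * T := by
        rcases isEmpty_or_nonempty (Fin m) with hm | ⟨⟨j⟩⟩
        · have : strongNorm 1 (fun j => φ (x j)) = 0 := by rw [strongNorm_one]; simp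
          have h0 : weakNorm 𝕜 1 x = 0 := le_antisymm
            (weakNorm_le fun ψ _ => by rw [strongNorm_one]; simp) (weakNorm_nonneg (by simp) x)
          simp [this, h0]
        · rw [mul_comm]
          exact mul_le_mul_of_nonneg_right (strongNorm_apply_le_weakNorm (by simp) x hφ)
            ((norm_nonneg _).trans (ha j))

end SequenceNorms

/-! ### Fourth moments of Rademacher sums -/

lemma sum_signs_succ {n : ℕ} (f : (Fin (n + 1) → ℤˣ) → ℝ) :
    ∑ ε, f ε = ∑ ε : Fin n → ℤˣ, (f (Fin.cons 1 ε) + f (Fin.cons (-1) ε)) := by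
  rw [← (Fin.consEquiv fun _ : Fin (n + 1) => ℤˣ).sum_comp, Fintype.sum_prod_type,
    Finset.sum_add_distrib, UnitsInt.univ, Finset.sum_pair (by decide)]
  rfl

lemma sum_signs_norm_sq (𝕜 : Type*) {H : Type*} [RCLike 𝕜] [NormedAddCommGroup H]
    [InnerProductSpace 𝕜 H] {n : ℕ} (a : Fin n → H) :
    ∑ ε : Fin n → ℤˣ, ‖∑ i, ε i • a i‖ ^ 2 = 2 ^ n * ∑ i, ‖a i‖ ^ 2 := by
  induction n with
  | zero => simp
  | succ n ih =>
    have par : ∀ u v : H, ‖u + v‖ ^ 2 + ‖-u + v‖ ^ 2 = 2 * ‖v‖ ^ 2 + 2 * ‖u‖ ^ 2 := by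
      intro u v
      have := parallelogram_law_with_norm 𝕜 v u
      rw [add_comm u, neg_add_eq_sub]
      nlinarith
    rw [sum_signs_succ]
    simp only [Fin.sum_univ_succ, Fin.cons_zero, Fin.cons_succ, one_smul, Units.neg_smul, par,
      Finset.sum_add_distrib, ← Finset.mul_sum, ih]
    simp
    ring

lemma norm_add_pow_four_add_le (𝕜 : Type*) {H : Type*} [RCLike 𝕜] [NormedAddCommGroup H]
    [InnerProductSpace 𝕜 H] (u v : H) :
    ‖u + v‖ ^ 4 + ‖-u + v‖ ^ 4 ≤ 2 * ‖v‖ ^ 4 + 12 * ‖u‖ ^ 2 * ‖v‖ ^ 2 + 2 * ‖u‖ ^ 4 := by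
  have h1 := norm_add_sq (𝕜 := 𝕜) u v
  have h2 := norm_add_sq (𝕜 := 𝕜) (-u) v
  rw [inner_neg_left, map_neg, norm_neg] at h2
  have h3 := abs_le.1 ((RCLike.abs_re_le_norm _).trans (norm_inner_le_norm (𝕜 := 𝕜) u v))
  set r := RCLike.re (inner 𝕜 u v)
  have h4 : r ^ 2 ≤ (‖u‖ * ‖v‖) ^ 2 := by nlinarith [h3.1, h3.2]
  have e1 : ‖u + v‖ ^ 4 = (‖u + v‖ ^ 2) ^ 2 := by ring
  have e2 : ‖-u + v‖ ^ 4 = (‖-u + v‖ ^ 2) ^ 2 := by ring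
  rw [e1, e2, h1, h2]
  nlinarith

/-- Khinchin's inequality for the fourth moment. -/
lemma sum_signs_norm_pow_four_le (𝕜 : Type*) {H : Type*} [RCLike 𝕜] [NormedAddCommGroup H]
    [InnerProductSpace 𝕜 H] {n : ℕ} (a : Fin n → H) :
    ∑ ε : Fin n → ℤˣ, ‖∑ i, ε i • a i‖ ^ 4 ≤ 2 ^ n * (3 * (∑ i, ‖a i‖ ^ 2) ^ 2) := by
  induction n with
  | zero => simp
  | succ n ih =>
    rw [sum_signs_succ]
    simp only [Fin.sum_univ_succ, Fin.cons_zero, Fin.cons_succ, one_smul, Units.neg_smul]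
    refine (Finset.sum_le_sum fun ε _ => norm_add_pow_four_add_le 𝕜 _ _).trans ?_
    simp only [Finset.sum_add_distrib, ← Finset.mul_sum, sum_signs_norm_sq 𝕜]
    have h := ih fun i => a i.succ
    simp only [Finset.sum_const, Finset.card_univ, Fintype.card_pi, Fintype.card_units_int,
      Finset.prod_const, Fintype.card_fin, nsmul_eq_mul, Nat.cast_pow, Nat.cast_ofNat]
    set Q := ∑ i : Fin n, ‖a i.succ‖ ^ 2
    have : 0 ≤ (2 : ℝ) ^ n * ‖a 0‖ ^ 4 := by positivity
    rw [pow_succ (2 : ℝ) n]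
    nlinarith

/-! ### Pietsch domination on a finite set -/

/-- A convex set of vectors none of which has all coordinates negative lies on the nonnegative side
of a probability vector. -/
lemma exists_prob_of_convex {m : ℕ} {t : Set (Fin m → ℝ)} (ht : Convex ℝ t) (hne : t.Nonempty)
    (h : ∀ v ∈ t, ∃ j, 0 ≤ v j) :
    ∃ μ : Fin m → ℝ, (∀ j, 0 ≤ μ j) ∧ ∑ j, μ j = 1 ∧ ∀ v ∈ t, 0 ≤ ∑ j, μ j * v j := by
  have hs : (Set.univ.pi fun _ : Fin m => Set.Iio (0 : ℝ)) = {v | ∀ j, v j < 0} := by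
    ext; simp
  obtain ⟨f, u, hfu, huf⟩ := geometric_hahn_banach_open
    (s := Set.univ.pi fun _ : Fin m => Set.Iio (0 : ℝ))
    (convex_pi fun _ _ => convex_Iio 0) (isOpen_set_pi Set.finite_univ fun _ _ => isOpen_Iio) ht
    (Set.disjoint_left.2 fun v hv hv' => by
      obtain ⟨j, hj⟩ := h v hv'
      exact absurd (hv j (Set.mem_univ j)) (not_lt.2 hj))
  have hf : ∀ v, f v = ∑ j, f (Pi.single j 1) * v j := fun v => by
    conv_lhs => rw [← Finset.univ_sum_single v, map_sum]
    refine Finset.sum_congr rfl fun j _ => ?_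
    have : (Pi.single j (v j) : Fin m → ℝ) = v j • Pi.single j 1 := by
      rw [← Pi.single_smul]; simp
    rw [this, map_smul, smul_eq_mul, mul_comm]
  -- The negative orthant is a cone, so `f` is nonpositive on its closure and `u ≥ 0`.
  have hcone : ∀ v : Fin m → ℝ, (∀ j, v j < 0) → f v ≤ 0 := by
    intro v hv
    by_contra! hpos
    obtain ⟨N, hN⟩ := exists_nat_gt (u / f v)
    have := hfu (((N : ℝ) + 1) • v) fun j _ => mul_neg_of_pos_of_neg (by positivity) (hv j)
    rw [map_smul, smul_eq_mul] at this
    rw [div_lt_iff₀ hpos] at hN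
    linarith
  have hu : 0 ≤ u := by
    by_contra! hneg
    have h1 : Filter.Tendsto (fun c : ℝ => f (c • fun _ => (-1 : ℝ))) (nhdsWithin 0 (Set.Ioi 0))
        (nhds (f ((0 : ℝ) • fun _ => (-1 : ℝ)))) :=
      ((by fun_prop : Continuous fun c : ℝ => f (c • fun _ => (-1 : ℝ))).tendsto 0).mono_left
        nhdsWithin_le_nhds
    have h2 : f ((0 : ℝ) • fun _ => (-1 : ℝ)) ≤ u := le_of_tendsto h1 <| by
      filter_upwards [self_mem_nhdsWithin] with c hc
      exact (hfu _ fun j _ => by simpa using hc).le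
    rw [zero_smul, map_zero] at h2
    linarith
  have hnn : ∀ j, 0 ≤ f (Pi.single j 1) := by
    intro j
    have h1 : Filter.Tendsto (fun c : ℝ => f (c • (fun _ => (-1 : ℝ)) - Pi.single j 1))
        (nhdsWithin 0 (Set.Ioi 0)) (nhds (f ((0 : ℝ) • (fun _ => (-1 : ℝ)) - Pi.single j 1))) :=
      ((by fun_prop : Continuous fun c : ℝ =>
        f (c • (fun _ => (-1 : ℝ)) - Pi.single j 1)).tendsto 0).mono_left nhdsWithin_le_nhds
    have h2 : f ((0 : ℝ) • (fun _ => (-1 : ℝ)) - Pi.single j 1) ≤ 0 := le_of_tendsto h1 <| by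
      filter_upwards [self_mem_nhdsWithin] with c hc
      refine hcone _ fun i => ?_
      have h3 : (0 : ℝ) ≤ (Pi.single j 1 : Fin m → ℝ) i := by
        by_cases hij : i = j
        · subst hij; simp
        · simp [hij]
      have hc' : (0 : ℝ) < c := hc
      simp only [Pi.sub_apply, Pi.smul_apply, smul_eq_mul]
      linarith
    rw [zero_smul, zero_sub, map_neg] at h2
    linarith
  have hS : 0 < ∑ j, f (Pi.single j 1) := by
    refine (Finset.sum_nonneg fun j _ => hnn j).lt_of_ne' fun h0 => ?_
    have hz : ∀ j, f (Pi.single j 1) = 0 := fun j =>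
      (Finset.sum_eq_zero_iff_of_nonneg fun j _ => hnn j).1 h0 j (Finset.mem_univ j)
    have hf0 : ∀ v, f v = 0 := fun v => by rw [hf]; simp [hz]
    obtain ⟨v, hv⟩ := hne
    have h1 := huf v hv
    have h2 := hfu (fun _ => -1) fun j _ => by simp
    rw [hf0] at h1 h2
    linarith
  refine ⟨fun j => f (Pi.single j 1) / ∑ j, f (Pi.single j 1), fun j => div_nonneg (hnn j) hS.le,
    by rw [← Finset.sum_div, div_self hS.ne'], fun v hv => ?_⟩
  simp_rw [div_mul_eq_mul_div, ← Finset.sum_div, ← hf]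
  exact div_nonneg (hu.trans (huf v hv)) hS.le

/-- Pietsch domination for the operator `e j ↦ x j` on the finite-dimensional `ℓ_∞`: a `2`-summing
inequality yields a dominating probability vector. -/
lemma exists_prob_of_two_summing {𝕜 E : Type*} [RCLike 𝕜] [NormedAddCommGroup E] [NormedSpace 𝕜 E]
    {m : ℕ} (x : Fin (m + 1) → E) {K : ℝ}
    (h : ∀ (n : ℕ) (f : Fin n → Fin (m + 1) → 𝕜) (M : ℝ), 0 < M →
      (∀ j, ∑ i, ‖f i j‖ ^ 2 ≤ M) → ∑ i, ‖∑ j, f i j • x j‖ ^ 2 ≤ K * M) :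
    ∃ μ : Fin (m + 1) → ℝ, (∀ j, 0 ≤ μ j) ∧ ∑ j, μ j = 1 ∧
      ∀ a : Fin (m + 1) → 𝕜, ‖∑ j, a j • x j‖ ^ 2 ≤ K * ∑ j, μ j * ‖a j‖ ^ 2 := by
  set V : (Fin (m + 1) → 𝕜) → Fin (m + 1) → ℝ :=
    fun a j => K * ‖a j‖ ^ 2 - ‖∑ j, a j • x j‖ ^ 2 with hV
  obtain ⟨μ, hμ, hμ1, hμV⟩ := exists_prob_of_convex (convex_convexHull ℝ (Set.range V))
    ⟨_, subset_convexHull ℝ _ ⟨0, rfl⟩⟩ (by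
      intro v hv
      obtain ⟨ι, _, w, z, hw, -, hz, rfl⟩ := mem_convexHull_iff_exists_fintype.1 hv
      choose g hg using hz
      -- A convex combination of the vectors `V a` is a sum of vectors `V a` after rescaling `a`.
      let f : ι → Fin (m + 1) → 𝕜 := fun i j => ((√(w i) : ℝ) : 𝕜) * g i j
      have hf1 : ∀ i j, ‖f i j‖ ^ 2 = w i * ‖g i j‖ ^ 2 := fun i j => by
        simp only [f, norm_mul, RCLike.norm_ofReal, mul_pow, sq_abs, Real.sq_sqrt (hw i)]
      have hf2 : ∀ i, ‖∑ j, f i j • x j‖ ^ 2 = w i * ‖∑ j, g i j • x j‖ ^ 2 := fun i => by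
        simp only [f, mul_smul, ← Finset.smul_sum, norm_smul, RCLike.norm_ofReal, mul_pow, sq_abs,
          Real.sq_sqrt (hw i)]
      obtain ⟨j₀, hj₀⟩ := Finite.exists_max fun j => ∑ i, ‖f i j‖ ^ 2
      refine ⟨j₀, ?_⟩
      have hval : (∑ i, w i • z i) j₀ =
          K * ∑ i, ‖f i j₀‖ ^ 2 - ∑ i, ‖∑ j, f i j • x j‖ ^ 2 := by
        simp only [Finset.sum_apply, Pi.smul_apply, smul_eq_mul, ← hg, hV, hf1, hf2,
          Finset.mul_sum, ← Finset.sum_sub_distrib]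
        exact Finset.sum_congr rfl fun i _ => by ring
      rw [hval, sub_nonneg]
      rcases (Finset.sum_nonneg fun i _ => sq_nonneg ‖f i j₀‖).eq_or_lt with h0 | hpos
      · have hz : ∀ i j, f i j = 0 := fun i j => by
          have h1 := hj₀ j
          rw [← h0] at h1
          have h2 := Finset.single_le_sum (f := fun i => ‖f i j‖ ^ 2)
            (fun i _ => sq_nonneg _) (Finset.mem_univ i)
          have h3 : ‖f i j‖ ^ 2 = 0 := le_antisymm (h2.trans h1) (sq_nonneg _)
          simpa using h3
        simp [hz]
      · have := h _ (fun i => f ((Fintype.equivFin ι).symm i)) _ hpos fun j => by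
          rw [(Fintype.equivFin ι).symm.sum_comp fun i => ‖f i j‖ ^ 2]
          exact hj₀ j
        rwa [(Fintype.equivFin ι).symm.sum_comp fun i => ‖∑ j, f i j • x j‖ ^ 2] at this)
  refine ⟨μ, hμ, hμ1, fun a => ?_⟩
  have := hμV _ (subset_convexHull ℝ _ ⟨a, rfl⟩)
  simp only [hV, mul_sub, Finset.sum_sub_distrib, ← Finset.sum_mul, hμ1, one_mul] at this
  rw [Finset.mul_sum]
  refine (sub_nonneg.1 this).trans_eq (Finset.sum_congr rfl fun j _ => by ring)

/-! ### Factorization in spaces of cotype two -/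

section Cotype

variable {𝕜 E : Type*} [RCLike 𝕜] [NormedAddCommGroup E] [NormedSpace 𝕜 E] {m : ℕ}

variable (𝕜) in
/-- The operator `u : e j ↦ x j` on the finite-dimensional `ℓ_∞` satisfies
`‖u a‖ ≤ κ ‖a‖_{L_2(μ)}` for some probability vector `μ` with nonzero coordinates. -/
def IsHilbertDominated (x : Fin m → E) (κ : ℝ) : Prop :=
  ∃ μ : Fin m → ℝ, (∀ j, 0 < μ j) ∧ ∑ j, μ j = 1 ∧
    ∀ a : Fin m → 𝕜, ‖∑ j, a j • x j‖ ^ 2 ≤ κ ^ 2 * ∑ j, μ j * ‖a j‖ ^ 2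

/-- Domination with some constant holds for every finite sequence, with the uniform weights. -/
lemma exists_isHilbertDominated (x : Fin (m + 1) → E) :
    ∃ κ, 0 < κ ∧ IsHilbertDominated 𝕜 x κ := by
  have hS : 0 ≤ ∑ j, ‖x j‖ ^ 2 := Finset.sum_nonneg fun _ _ => sq_nonneg _
  have hm : (0 : ℝ) < m + 1 := by positivity
  refine ⟨√((m + 1) * (∑ j, ‖x j‖ ^ 2) + 1), by positivity, fun _ => 1 / (m + 1),
    fun _ => by positivity, by simp [hm.ne'], fun a => ?_⟩
  have h1 : ‖∑ j, a j • x j‖ ≤ ∑ j, ‖a j‖ * ‖x j‖ :=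
    (norm_sum_le _ _).trans_eq (by simp [norm_smul])
  have h2 := Finset.sum_mul_sq_le_sq_mul_sq Finset.univ (fun j => ‖a j‖) fun j => ‖x j‖
  rw [Real.sq_sqrt (by positivity), ← Finset.mul_sum]
  calc ‖∑ j, a j • x j‖ ^ 2 ≤ (∑ j, ‖a j‖ * ‖x j‖) ^ 2 := by gcongr
    _ ≤ _ := h2
    _ = (m + 1) * (∑ j, ‖x j‖ ^ 2) * (1 / (m + 1) * ∑ j, ‖a j‖ ^ 2) := by field_simp
    _ ≤ _ := by
      have : 0 ≤ 1 / ((m : ℝ) + 1) * ∑ j, ‖a j‖ ^ 2 := by positivity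
      nlinarith

/-- Interpolation between an `L_2(μ)` bound and an `ℓ_∞` bound: the part of `a` with
`‖a j‖ ^ 2 ≤ τ` is estimated by the sup norm, the remaining part in `L_2(μ)`. -/
lemma norm_sq_le_of_truncation {x : Fin m → E} {μ : Fin m → ℝ} {κ W : ℝ}
    (hμ : ∀ j, 0 ≤ μ j)
    (hκ : ∀ a : Fin m → 𝕜, ‖∑ j, a j • x j‖ ^ 2 ≤ κ ^ 2 * ∑ j, μ j * ‖a j‖ ^ 2)
    (hW : ∀ (a : Fin m → 𝕜) (T : ℝ), (∀ j, ‖a j‖ ≤ T) → ‖∑ j, a j • x j‖ ≤ W * T)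
    {τ : ℝ} (hτ : 0 < τ) (a : Fin m → 𝕜) :
    ‖∑ j, a j • x j‖ ^ 2 ≤ 2 * (W ^ 2 * τ) + 2 * (κ ^ 2 * ((∑ j, μ j * ‖a j‖ ^ 4) / τ)) := by
  let b : Fin m → 𝕜 := fun j => if ‖a j‖ ^ 2 ≤ τ then a j else 0
  let c : Fin m → 𝕜 := fun j => if ‖a j‖ ^ 2 ≤ τ then 0 else a j
  have habc : ∑ j, a j • x j = ∑ j, b j • x j + ∑ j, c j • x j := by
    rw [← Finset.sum_add_distrib]
    refine Finset.sum_congr rfl fun j _ => ?_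
    by_cases h : ‖a j‖ ^ 2 ≤ τ <;> simp [b, c, h]
  have hb : ‖∑ j, b j • x j‖ ^ 2 ≤ W ^ 2 * τ := by
    have h1 := hW b (√τ) fun j => by
      by_cases h : ‖a j‖ ^ 2 ≤ τ
      · simpa [b, h] using Real.le_sqrt_of_sq_le h
      · simp [b, h]
    calc ‖∑ j, b j • x j‖ ^ 2 ≤ (W * √τ) ^ 2 := by gcongr
      _ = W ^ 2 * τ := by rw [mul_pow, Real.sq_sqrt hτ.le]
  have hc : ‖∑ j, c j • x j‖ ^ 2 ≤ κ ^ 2 * ((∑ j, μ j * ‖a j‖ ^ 4) / τ) := by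
    refine (hκ c).trans (mul_le_mul_of_nonneg_left ?_ (sq_nonneg κ))
    rw [Finset.sum_div]
    refine Finset.sum_le_sum fun j _ => ?_
    rw [mul_div_assoc]
    refine mul_le_mul_of_nonneg_left ?_ (hμ j)
    rw [le_div_iff₀ hτ]
    by_cases h : ‖a j‖ ^ 2 ≤ τ
    · simp [c, h]
    · simp only [c, h, if_false]
      nlinarith [sq_nonneg ‖a j‖]
  rw [habc]
  calc _ ≤ (‖∑ j, b j • x j‖ + ‖∑ j, c j • x j‖) ^ 2 := by gcongr; exact norm_add_le _ _
    _ ≤ _ := by nlinarith [sq_nonneg (‖∑ j, b j • x j‖ - ‖∑ j, c j • x j‖)]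

lemma sum_signs_smul_comm {n : ℕ} (x : Fin m → E) (f : Fin n → Fin m → 𝕜) (ε : Fin n → ℤˣ) :
    ∑ i, ε i • ∑ j, f i j • x j = ∑ j, (∑ i, ε i • f i j) • x j := by
  simp_rw [Finset.smul_sum, Finset.sum_smul, Units.smul_def, smul_assoc]
  exact Finset.sum_comm

/-- In a space of cotype two, `L_2(μ)`-domination with constant `κ` and the sup norm bound `W`
give a `2`-summing inequality whose constant involves only the geometric mean of `κ` and `W`. -/
lemma two_summing_of_dominated {C : ℝ} (hC : 0 < C)
    (hE : ∀ (n : ℕ) (y : Fin n → E), √(∑ i, ‖y i‖ ^ 2) ≤ C * rademacherAverage y)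
    {x : Fin m → E} {μ : Fin m → ℝ} {κ W : ℝ} (hκ0 : 0 < κ) (hW0 : 0 < W)
    (hμ : ∀ j, 0 ≤ μ j) (hμ1 : ∑ j, μ j = 1)
    (hκ : ∀ a : Fin m → 𝕜, ‖∑ j, a j • x j‖ ^ 2 ≤ κ ^ 2 * ∑ j, μ j * ‖a j‖ ^ 2)
    (hW : ∀ (a : Fin m → 𝕜) (T : ℝ), (∀ j, ‖a j‖ ≤ T) → ‖∑ j, a j • x j‖ ≤ W * T)
    {n : ℕ} (f : Fin n → Fin m → 𝕜) {M : ℝ} (hM : 0 < M) (hf : ∀ j, ∑ i, ‖f i j‖ ^ 2 ≤ M) :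
    ∑ i, ‖∑ j, f i j • x j‖ ^ 2 ≤ 8 * C ^ 2 * κ * W * M := by
  have hcot : ∑ i, ‖∑ j, f i j • x j‖ ^ 2 ≤
      C ^ 2 * ((∑ ε : Fin n → ℤˣ, ‖∑ i, ε i • ∑ j, f i j • x j‖ ^ 2) / 2 ^ n) := by
    have h := hE n fun i => ∑ j, f i j • x j
    rw [Real.sqrt_le_left (by unfold rademacherAverage; positivity), mul_pow,
      rademacherAverage, Real.sq_sqrt (by positivity)] at h
    exact h
  have hmom : ∑ ε : Fin n → ℤˣ, ∑ j, μ j * ‖∑ i, ε i • f i j‖ ^ 4 ≤ 2 ^ n * (3 * M ^ 2) := by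
    rw [Finset.sum_comm]
    calc ∑ j, ∑ ε : Fin n → ℤˣ, μ j * ‖∑ i, ε i • f i j‖ ^ 4
        ≤ ∑ j, μ j * (2 ^ n * (3 * M ^ 2)) := by
          refine Finset.sum_le_sum fun j _ => ?_
          rw [← Finset.mul_sum]
          refine mul_le_mul_of_nonneg_left
            ((sum_signs_norm_pow_four_le 𝕜 fun i => f i j).trans ?_) (hμ j)
          gcongr
          exact hf j
      _ = _ := by rw [← Finset.sum_mul, hμ1, one_mul]
  -- The truncation level `κ M / W` balances the two terms.
  have hτ : 0 < κ * M / W := by positivity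
  have hsum : ∑ ε : Fin n → ℤˣ, ‖∑ i, ε i • ∑ j, f i j • x j‖ ^ 2 ≤ 2 ^ n * (8 * κ * W * M) := by
    calc ∑ ε : Fin n → ℤˣ, ‖∑ i, ε i • ∑ j, f i j • x j‖ ^ 2
        ≤ ∑ ε : Fin n → ℤˣ, (2 * κ * W * M +
          2 * κ * W / M * ∑ j, μ j * ‖∑ i, ε i • f i j‖ ^ 4) := by
          refine Finset.sum_le_sum fun ε _ => ?_
          rw [sum_signs_smul_comm]
          refine (norm_sq_le_of_truncation hμ hκ hW hτ _).trans_eq ?_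
          field_simp
      _ = 2 ^ n * (2 * κ * W * M) + 2 * κ * W / M *
          ∑ ε : Fin n → ℤˣ, ∑ j, μ j * ‖∑ i, ε i • f i j‖ ^ 4 := by
          rw [Finset.sum_add_distrib, Finset.sum_const, ← Finset.mul_sum]
          simp
      _ ≤ 2 ^ n * (2 * κ * W * M) + 2 * κ * W / M * (2 ^ n * (3 * M ^ 2)) := by gcongr
      _ = _ := by field_simp; ring
  calc _ ≤ _ := hcot
    _ ≤ C ^ 2 * ((2 ^ n * (8 * κ * W * M)) / 2 ^ n) := by gcongr
    _ = _ := by field_simp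

/-- The extrapolation step: in a space of cotype two, a domination constant `κ` can be replaced by
a multiple of the geometric mean of `κ` and the sup norm bound `W`. -/
lemma IsHilbertDominated.improve {C : ℝ} (hC : 0 < C)
    (hE : ∀ (n : ℕ) (y : Fin n → E), √(∑ i, ‖y i‖ ^ 2) ≤ C * rademacherAverage y)
    {x : Fin (m + 1) → E} {κ W : ℝ} (hκ0 : 0 < κ) (hW0 : 0 < W)
    (hW : ∀ (a : Fin (m + 1) → 𝕜) (T : ℝ), (∀ j, ‖a j‖ ≤ T) → ‖∑ j, a j • x j‖ ≤ W * T)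
    (h : IsHilbertDominated 𝕜 x κ) : IsHilbertDominated 𝕜 x (√(16 * C ^ 2 * W * κ)) := by
  obtain ⟨μ, hμ, hμ1, hκ⟩ := h
  obtain ⟨ν, hν, hν1, hx⟩ := exists_prob_of_two_summing (𝕜 := 𝕜) x
    fun n f M hM hf => two_summing_of_dominated hC hE hκ0 hW0 (fun j => (hμ j).le) hμ1 hκ hW f hM hf
  -- Averaging `ν` with the uniform weights makes all coordinates positive.
  refine ⟨fun j => (ν j + 1 / (m + 1)) / 2, fun j => ?_, ?_, fun a => (hx a).trans ?_⟩
  · have := hν j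
    positivity
  · rw [← Finset.sum_div, Finset.sum_add_distrib, hν1]
    have : (m : ℝ) + 1 ≠ 0 := by positivity
    simp [this]
  · rw [Real.sq_sqrt (by positivity), Finset.mul_sum, Finset.mul_sum]
    refine Finset.sum_le_sum fun j _ => ?_
    have h1 : 0 ≤ 8 * C ^ 2 * κ * W * ‖a j‖ ^ 2 * (1 / ((m : ℝ) + 1)) := by positivity
    nlinarith

/-- In a space of cotype two, the operator `e j ↦ x j` on `ℓ_∞` is dominated by an `L_2(μ)` norm
with a constant proportional to its norm. -/
lemma exists_isHilbertDominated_le {C : ℝ} (hC : 0 < C)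
    (hE : ∀ (n : ℕ) (y : Fin n → E), √(∑ i, ‖y i‖ ^ 2) ≤ C * rademacherAverage y)
    {x : Fin (m + 1) → E} {W : ℝ} (hW0 : 0 < W)
    (hW : ∀ (a : Fin (m + 1) → 𝕜) (T : ℝ), (∀ j, ‖a j‖ ≤ T) → ‖∑ j, a j • x j‖ ≤ W * T) :
    ∃ κ, 0 < κ ∧ κ ≤ 32 * C ^ 2 * W ∧ IsHilbertDominated 𝕜 x κ := by
  by_contra! hcon
  set D : Set ℝ := {κ | 0 < κ ∧ IsHilbertDominated 𝕜 x κ} with hD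
  have hne : D.Nonempty := exists_isHilbertDominated x
  have hlow : ∀ κ ∈ D, 32 * C ^ 2 * W ≤ κ := fun κ hκ => by
    by_contra! hlt
    exact hcon κ hκ.1 hlt.le hκ.2
  have hinf : 32 * C ^ 2 * W ≤ sInf D := le_csInf hne hlow
  have hB : 0 < 32 * C ^ 2 * W := by positivity
  obtain ⟨κ, hκ, hκlt⟩ := exists_lt_of_csInf_lt hne (by linarith : sInf D < 2 * sInf D)
  have hmem : √(16 * C ^ 2 * W * κ) ∈ D :=
    ⟨Real.sqrt_pos.2 (by have := hκ.1; positivity), hκ.2.improve hC hE hκ.1 hW0 hW⟩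
  have h1 : sInf D ≤ √(16 * C ^ 2 * W * κ) := csInf_le ⟨_, hlow⟩ hmem
  have h2 : √(16 * C ^ 2 * W * κ) < sInf D := by
    rw [Real.sqrt_lt' (by linarith)]
    nlinarith [hκ.1]
  linarith

/-- By duality, `L_2(μ)`-domination says that `(μ j) ^ (-1/2) • x j` is weakly `2`-summable. -/
lemma weakNorm_two_le_of_dominated {x : Fin m → E} {μ : Fin m → ℝ} {κ : ℝ} (hκ0 : 0 < κ)
    (hμ : ∀ j, 0 < μ j)
    (hκ : ∀ a : Fin m → 𝕜, ‖∑ j, a j • x j‖ ^ 2 ≤ κ ^ 2 * ∑ j, μ j * ‖a j‖ ^ 2) :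
    weakNorm 𝕜 2 (fun j => ((μ j ^ (-(1 / 2) : ℝ) : ℝ) : 𝕜) • x j) ≤ κ := by
  refine weakNorm_le fun φ hφ => ?_
  refine (sq_le_sq₀ (strongNorm_nonneg (by norm_num) _) hκ0.le).1 ?_
  have hS : strongNorm 2 (fun j => φ (((μ j ^ (-(1 / 2) : ℝ) : ℝ) : 𝕜) • x j)) ^ 2 =
      ∑ j, ‖φ (x j)‖ ^ 2 / μ j := by
    rw [strongNorm_two_sq]
    refine Finset.sum_congr rfl fun j _ => ?_
    rw [map_smul, norm_smul, mul_pow, RCLike.norm_ofReal, sq_abs, ← Real.rpow_natCast,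
      ← Real.rpow_mul (hμ j).le]
    norm_num [Real.rpow_neg_one]
    field_simp
  rw [hS]
  set S := ∑ j, ‖φ (x j)‖ ^ 2 / μ j
  have hS0 : 0 ≤ S := Finset.sum_nonneg fun j _ => div_nonneg (sq_nonneg _) (hμ j).le
  -- The extremal coefficients in the duality between `L_2(μ)` and itself.
  let a : Fin m → 𝕜 := fun j => (starRingEnd 𝕜) (φ (x j)) / ((μ j : ℝ) : 𝕜)
  have h1 : φ (∑ j, a j • x j) = (S : 𝕜) := by
    simp only [S, map_sum, map_smul, smul_eq_mul, a]
    push_cast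
    refine Finset.sum_congr rfl fun j _ => ?_
    rw [← RCLike.conj_mul]
    ring
  have h2 : S ≤ ‖∑ j, a j • x j‖ := by
    have := φ.le_of_opNorm_le hφ (∑ j, a j • x j)
    rwa [h1, RCLike.norm_ofReal, abs_of_nonneg hS0, one_mul] at this
  have h3 : ∑ j, μ j * ‖a j‖ ^ 2 = S := by
    refine Finset.sum_congr rfl fun j _ => ?_
    have := hμ j
    simp only [a, norm_div, RCLike.norm_conj, RCLike.norm_ofReal, abs_of_pos this]
    field_simp
  have h4 := hκ a
  rw [h3] at h4
  rcases hS0.eq_or_lt with h0 | hpos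
  · rw [← h0]; positivity
  · nlinarith

/-- In a space of cotype two, `ℓ_1^w = ℓ_{r*} ⋅ ℓ_r^w` for `1 ≤ r ≤ 2`: a weakly summable sequence
is the product of the scalar sequence `(μ j) ^ (1 - 1 / r)` and a weakly `r`-summable one. -/
lemma HasCotypeTwo.exists_factorization (𝕜 : Type*) {E : Type*} [RCLike 𝕜]
    [NormedAddCommGroup E] [NormedSpace 𝕜 E] (hE : HasCotypeTwo E) :
    ∃ c : ℝ, 0 < c ∧ ∀ r : ℝ≥0∞, 1 ≤ r → r ≤ 2 → ∀ (m : ℕ) (x : Fin m → E),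
      ∃ μ : Fin m → ℝ, (∀ j, 0 < μ j) ∧ ∑ j, μ j ≤ 1 ∧
        weakNorm 𝕜 r (fun j => ((μ j ^ (-(1 - (r⁻¹).toReal)) : ℝ) : 𝕜) • x j) ≤
          c * weakNorm 𝕜 1 x := by
  obtain ⟨C, hC, hCE⟩ := hE
  refine ⟨32 * C ^ 2, by positivity, fun r hr1 hr2 m x => ?_⟩
  have hr0 : 0 < r := one_pos.trans_le hr1
  have hrt : r ≠ ⊤ := (hr2.trans_lt (by norm_num)).ne
  rcases m with _ | m
  · refine ⟨fun _ => 1, fun _ => one_pos, by simp, ?_⟩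
    refine le_trans (weakNorm_le fun φ _ => ?_)
      (mul_nonneg (by positivity) (weakNorm_nonneg one_pos x))
    exact strongNorm_le_of_sum_le hr0 hrt le_rfl
      (by simp [Real.zero_rpow (ENNReal.toReal_pos hr0.ne' hrt).ne'])
  have hW : ∀ (a : Fin (m + 1) → 𝕜) (T : ℝ), (∀ j, ‖a j‖ ≤ T) →
      ‖∑ j, a j • x j‖ ≤ weakNorm 𝕜 1 x * T := fun a T => norm_sum_smul_le_weakNorm_one x
  rcases (weakNorm_nonneg (𝕜 := 𝕜) one_pos x).eq_or_lt with h0 | hpos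
  · have hx : ∀ j, x j = 0 := fun j => by
      have := hW (Pi.single j 1) 1 fun i => by
        by_cases h : i = j
        · subst h; simp
        · simp [h]
      rw [← h0, Finset.sum_eq_single j (fun i _ h => by simp [h]) (by simp)] at this
      simpa using this
    refine ⟨fun _ => 1 / (m + 1), fun _ => by positivity, ?_, ?_⟩
    · have : (m : ℝ) + 1 ≠ 0 := by positivity
      simp [this]
    · rw [← h0, mul_zero]
      refine weakNorm_le fun φ _ => strongNorm_le_of_sum_le hr0 hrt le_rfl ?_
      simp [hx, Real.zero_rpow (ENNReal.toReal_pos hr0.ne' hrt).ne']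
  obtain ⟨κ, hκ0, hκle, μ, hμ, hμ1, hκ⟩ := exists_isHilbertDominated_le hC hCE hpos hW
  refine ⟨μ, hμ, hμ1.le, ?_⟩
  have hinv : (2⁻¹ : ℝ) ≤ (r⁻¹).toReal := by
    have := ENNReal.toReal_mono (by simp [hr0.ne']) (ENNReal.inv_le_inv.2 hr2)
    simpa using this
  have h := weakNorm_rpow_smul_le (𝕜 := 𝕜) hr0 hr2 (s := (r⁻¹).toReal - 2⁻¹) (by linarith)
    (by simp) (fun j => (hμ j).le) hμ1.le fun j => ((μ j ^ (-(1 / 2) : ℝ) : ℝ) : 𝕜) • x j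
  have heq : ∀ j, ((μ j ^ (-(1 - (r⁻¹).toReal)) : ℝ) : 𝕜) • x j =
      ((μ j ^ ((r⁻¹).toReal - 2⁻¹) : ℝ) : 𝕜) • ((μ j ^ (-(1 / 2) : ℝ) : ℝ) : 𝕜) • x j := fun j => by
    rw [smul_smul, ← RCLike.ofReal_mul, ← Real.rpow_add (hμ j)]
    congr 3
    ring
  simp_rw [heq]
  exact h.trans ((weakNorm_two_le_of_dominated hκ0 hμ hκ).trans hκle)

end Cotype

/-! ### Comparison of summing bounds -/

section Multilinear

variable {𝕜 : Type*} [RCLike 𝕜] {n : ℕ} {E : Fin n → Type*} [∀ i, NormedAddCommGroup (E i)]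
  [∀ i, NormedSpace 𝕜 (E i)] {F : Type*} [NormedAddCommGroup F] [NormedSpace 𝕜 F]
  {p q : ℝ≥0∞} {ps qs : Fin n → ℝ≥0∞} {s : Fin n → ℝ}

/-- Passing to larger exponents: if multiplication by `w ^ s i`, for subprobability vectors `w`, maps
`ℓ_{q_i}^w` into `ℓ_{p_i}^w` with norm at most one, then a `(p; p_1, …, p_n)`-summing bound is a
`(q; q_1, …, q_n)`-summing bound. -/
lemma IsSummingBound.of_le (hp : 0 < p) (hpq : p ≤ q) (hs : ∀ i, 0 ≤ s i)
    (hsum : (p⁻¹).toReal = (q⁻¹).toReal + ∑ i, s i) (hps : ∀ i, 0 < ps i) (hqs : ∀ i, 0 < qs i)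
    (h : ∀ (i : Fin n) (m : ℕ) (x : Fin m → E i) (w : Fin m → ℝ), (∀ j, 0 ≤ w j) → ∑ j, w j ≤ 1 →
      weakNorm 𝕜 (ps i) (fun j => ((w j ^ s i : ℝ) : 𝕜) • x j) ≤ weakNorm 𝕜 (qs i) x)
    {A : ContinuousMultilinearMap 𝕜 E F} {C : ℝ} (hC : 0 < C) (hA : IsSummingBound p ps A C) :
    IsSummingBound q qs A C := by
  intro m x
  have hq : 0 < q := hp.trans_le hpq
  have hR : 0 ≤ C * ∏ i, weakNorm 𝕜 (qs i) (x i) :=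
    mul_nonneg hC.le (Finset.prod_nonneg fun i _ => weakNorm_nonneg (hqs i) _)
  set y : Fin m → F := fun j => A fun i => x i j with hy
  have key : ∀ w : Fin m → ℝ, (∀ j, 0 ≤ w j) → ∑ j, w j ≤ 1 →
      strongNorm p (fun j => ((w j ^ ∑ i, s i : ℝ) : 𝕜) • y j) ≤
        C * ∏ i, weakNorm 𝕜 (qs i) (x i) := by
    intro w hw hw1
    have h1 := hA m fun i j => ((w j ^ s i : ℝ) : 𝕜) • x i j
    have h2 : ∀ j, A (fun i => ((w j ^ s i : ℝ) : 𝕜) • x i j) =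
        ((w j ^ ∑ i, s i : ℝ) : 𝕜) • y j := fun j => by
      rw [A.map_smul_univ, Real.rpow_sum_of_nonneg (hw j) fun i _ => hs i]
      push_cast
      rfl
    simp_rw [h2] at h1
    exact h1.trans (mul_le_mul_of_nonneg_left
      (Finset.prod_le_prod (fun i _ => weakNorm_nonneg (hps i) _) fun i _ => h i m _ w hw hw1) hC.le)
  by_cases hq' : q = ⊤
  · subst hq'
    refine strongNorm_top_le hR fun j => ?_
    -- The unit vector weights pick out the term with index `j`.
    refine le_trans ?_ (key (Pi.single j 1) (fun i => ?_) (by simp))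
    · refine le_trans ?_ (norm_le_strongNorm hp _ j)
      simp
    · by_cases hij : i = j
      · subst hij; simp
      · simp [hij]
  have hp' : p ≠ ⊤ := fun h => hq' (top_le_iff.1 (h ▸ hpq))
  have hP := ENNReal.toReal_pos hp.ne' hp'
  have hQ := ENNReal.toReal_pos hq.ne' hq'
  rcases (strongNorm_nonneg hq y).eq_or_lt with h0 | hN
  · exact h0 ▸ hR
  set N := strongNorm q y
  have hw1 : ∑ j, (‖y j‖ / N) ^ q.toReal = 1 := by
    simp_rw [Real.div_rpow (norm_nonneg _) hN.le, ← Finset.sum_div]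
    rw [← strongNorm_rpow hq hq', div_self (Real.rpow_pos_of_pos hN _).ne']
  refine le_trans (le_of_eq ?_) (key (fun j => (‖y j‖ / N) ^ q.toReal) (fun j => by positivity)
    hw1.le)
  -- With these weights the left side is the `ℓ_p` norm of `N (‖y j‖ / N) ^ (q / p)`.
  have hterm : ∀ j, ‖((((‖y j‖ / N) ^ q.toReal) ^ (∑ i, s i) : ℝ) : 𝕜) • y j‖ ^ p.toReal =
      N ^ p.toReal * (‖y j‖ / N) ^ q.toReal := by
    intro j
    have ht : 0 ≤ ‖y j‖ / N := by positivity
    have hS : ∑ i, s i = p.toReal⁻¹ - q.toReal⁻¹ := by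
      rw [ENNReal.toReal_inv, ENNReal.toReal_inv] at hsum
      linarith
    have hSn : 0 ≤ ∑ i, s i := Finset.sum_nonneg fun i _ => hs i
    rw [norm_smul, RCLike.norm_ofReal, abs_of_nonneg (by positivity), ← Real.rpow_mul ht]
    have hyj : ‖y j‖ = N * (‖y j‖ / N) := by field_simp
    conv_lhs => rw [hyj]
    rw [mul_div_cancel_left₀ _ hN.ne', mul_left_comm, Real.mul_rpow hN.le (by positivity)]
    congr 1
    have h1 : (‖y j‖ / N) ^ (q.toReal * ∑ i, s i) * (‖y j‖ / N) =
        (‖y j‖ / N) ^ (q.toReal * ∑ i, s i + 1) := by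
      rw [Real.rpow_add_of_nonneg ht (by positivity) zero_le_one, Real.rpow_one]
    rw [h1, ← Real.rpow_mul ht, hS]
    congr 1
    field_simp
    ring
  rw [strongNorm_eq_sum hp hp']
  simp_rw [hterm]
  rw [← Finset.mul_sum, hw1, mul_one, ← Real.rpow_mul hN.le, mul_one_div_cancel hP.ne',
    Real.rpow_one]

/-- Passing to smaller exponents: if every weakly `p_i`-summable sequence is the product of a
sequence `w ^ s i`, with `w` a subprobability vector, and a weakly `q_i`-summable one, then a
`(q; q_1, …, q_n)`-summing bound gives a `(p; p_1, …, p_n)`-summing bound. -/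
lemma IsSummingBound.of_factorization (hp : 0 < p) (hpq : p ≤ q) (hs : ∀ i, 0 ≤ s i)
    (hsum : (p⁻¹).toReal = (q⁻¹).toReal + ∑ i, s i) (hqs : ∀ i, 0 < qs i) {c : Fin n → ℝ}
    (h : ∀ (i : Fin n) (m : ℕ) (x : Fin m → E i), ∃ w : Fin m → ℝ, (∀ j, 0 < w j) ∧ ∑ j, w j ≤ 1 ∧
      weakNorm 𝕜 (qs i) (fun j => ((w j ^ (-s i) : ℝ) : 𝕜) • x j) ≤ c i * weakNorm 𝕜 (ps i) x)
    {A : ContinuousMultilinearMap 𝕜 E F} {C : ℝ} (hC : 0 < C) (hA : IsSummingBound q qs A C) :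
    IsSummingBound p ps A ((∏ i, c i) * C) := by
  intro m x
  choose w hw hw1 hle using fun i => h i m (x i)
  set y : ∀ i, Fin m → E i := fun i j => ((w i j ^ (-s i) : ℝ) : 𝕜) • x i j
  have hxy : ∀ i j, x i j = ((w i j ^ s i : ℝ) : 𝕜) • y i j := fun i j => by
    rw [smul_smul, ← RCLike.ofReal_mul, ← Real.rpow_add (hw i j)]
    simp
  have hAx : ∀ j, A (fun i => x i j) = ((∏ i, w i j ^ s i : ℝ) : 𝕜) • A fun i => y i j := fun j => by
    simp_rw [hxy]
    rw [A.map_smul_univ]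
    push_cast
    rfl
  calc strongNorm p (fun j => A fun i => x i j)
      ≤ strongNorm q (fun j => A fun i => y i j) := by
        refine strongNorm_le_of_weights hp hpq hs hsum (fun i j => (hw i j).le) hw1 fun j => ?_
        rw [hAx, norm_smul, RCLike.norm_ofReal, abs_of_nonneg
          (Finset.prod_nonneg fun i _ => Real.rpow_nonneg (hw i j).le _)]
    _ ≤ C * ∏ i, weakNorm 𝕜 (qs i) (y i) := hA m y
    _ ≤ C * ∏ i, (c i * weakNorm 𝕜 (ps i) (x i)) :=
        mul_le_mul_of_nonneg_left
          (Finset.prod_le_prod (fun i _ => weakNorm_nonneg (hqs i) _) fun i _ => hle i) hC.le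
    _ = _ := by rw [Finset.prod_mul_distrib]; ring

lemma summingNorm_le_mul {A : ContinuousMultilinearMap 𝕜 E F} {c : ℝ} (hc : 0 < c)
    (hA : A ∈ summingMaps 𝕜 E F p ps)
    (h : ∀ C, 0 < C → IsSummingBound p ps A C → IsSummingBound q qs A (c * C)) :
    summingNorm q qs A ≤ c * summingNorm p ps A := by
  rw [← div_le_iff₀' hc]
  refine le_csInf hA fun C hC => ?_
  rw [div_le_iff₀' hc]
  exact csInf_le ⟨0, fun _ h => h.1.le⟩ ⟨mul_pos hc hC.1, h C hC.1 hC.2⟩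

end Multilinear

theorem mainTheorem7 {𝕜 : Type*} [RCLike 𝕜] {k l : ℕ} (hk : 1 ≤ k)
    (E : Fin (k + l) → Type*) [∀ i, NormedAddCommGroup (E i)] [∀ i, NormedSpace 𝕜 (E i)]
    [∀ i, CompleteSpace (E i)]
    (hE : ∀ i : Fin k, HasCotypeTwo (E (Fin.castAdd l i)))
    (p q : ℝ≥0∞) (qs : Fin k → ℝ≥0∞) (ps : Fin l → ℝ≥0∞)
    (hp : 0 < p) (hps : ∀ i, 0 < ps i)
    (hadm : p⁻¹ ≤ ∑ i, (Fin.append (fun _ : Fin k => (1 : ℝ≥0∞)) ps i)⁻¹)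
    (hpq : p ≤ q) (hqs : ∀ i, 1 ≤ qs i ∧ qs i ≤ 2)
    (hsum : ∑ i, ((qs i)⁻¹).toReal - (q⁻¹).toReal = (k : ℝ) - (p⁻¹).toReal)
    (F : Type*) [NormedAddCommGroup F] [NormedSpace 𝕜 F] [CompleteSpace F] :
    summingMaps 𝕜 E F p (Fin.append (fun _ : Fin k => (1 : ℝ≥0∞)) ps)
        = summingMaps 𝕜 E F q (Fin.append qs ps) ∧
      ∃ c : ℝ, 0 < c ∧
        ∀ A ∈ summingMaps 𝕜 E F p (Fin.append (fun _ : Fin k => (1 : ℝ≥0∞)) ps),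
          summingNorm q (Fin.append qs ps) A
              ≤ c * summingNorm p (Fin.append (fun _ : Fin k => (1 : ℝ≥0∞)) ps) A ∧
            summingNorm p (Fin.append (fun _ : Fin k => (1 : ℝ≥0∞)) ps) A
              ≤ c * summingNorm q (Fin.append qs ps) A := by
  -- The exponents `1 / q_i^*` of the weights, extended by zero.
  set s : Fin (k + l) → ℝ := Fin.append (fun i => 1 - ((qs i)⁻¹).toReal) fun _ => 0
  have hqs0 : ∀ i, 0 < qs i := fun i => one_pos.trans_le (hqs i).1
  have hs' : ∀ i, 0 ≤ 1 - ((qs i)⁻¹).toReal := fun i => by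
    have := ENNReal.toReal_mono ENNReal.one_ne_top (ENNReal.inv_le_one.2 (hqs i).1)
    simpa using this
  have hs : ∀ i, 0 ≤ s i := by
    refine Fin.addCases (fun i => ?_) fun i => ?_
    · simpa [s] using hs' i
    · simp [s]
  have hpos1 : ∀ i, 0 < Fin.append (fun _ : Fin k => (1 : ℝ≥0∞)) ps i := by
    refine Fin.addCases (fun i => ?_) fun i => ?_
    · simp
    · simpa using hps i
  have hpos2 : ∀ i, 0 < Fin.append qs ps i := by
    refine Fin.addCases (fun i => ?_) fun i => ?_
    · simpa using hqs0 i
    · simpa using hps i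
  have hsum' : (p⁻¹).toReal = (q⁻¹).toReal + ∑ i, s i := by
    rw [Fin.sum_univ_add]
    simp only [s, Fin.append_left, Fin.append_right, Finset.sum_sub_distrib, Finset.sum_const,
      Finset.card_univ, Fintype.card_fin, nsmul_eq_mul, mul_one, mul_zero, add_zero]
    linarith
  have up : ∀ (A : ContinuousMultilinearMap 𝕜 E F) (C : ℝ), 0 < C →
      IsSummingBound p (Fin.append (fun _ : Fin k => (1 : ℝ≥0∞)) ps) A C →
      IsSummingBound q (Fin.append qs ps) A C := by
    refine fun A C hC hA => IsSummingBound.of_le hp hpq hs hsum' hpos1 hpos2 ?_ hC hA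
    refine Fin.addCases (fun i m x w hw hw1 => ?_) fun i m x w hw hw1 => ?_
    · simp only [s, Fin.append_left]
      exact weakNorm_rpow_smul_le one_pos (hqs i).1 (hs' i) (by simp) hw hw1 x
    · simp only [s, Fin.append_right, Real.rpow_zero, RCLike.ofReal_one, one_smul, le_refl]
  choose c hc0 hc using fun i => (hE i).exists_factorization 𝕜
  have hc1 : ∀ i, 0 < Fin.append c (fun _ : Fin l => (1 : ℝ)) i := by
    refine Fin.addCases (fun i => ?_) fun i => ?_
    · simpa using hc0 i
    · simp
  set c' : ℝ := ∏ i, Fin.append c (fun _ : Fin l => (1 : ℝ)) i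
  have hc' : 0 < c' := Finset.prod_pos fun i _ => hc1 i
  have down : ∀ (A : ContinuousMultilinearMap 𝕜 E F) (C : ℝ), 0 < C →
      IsSummingBound q (Fin.append qs ps) A C →
      IsSummingBound p (Fin.append (fun _ : Fin k => (1 : ℝ≥0∞)) ps) A (c' * C) := by
    refine fun A C hC hA => IsSummingBound.of_factorization hp hpq hs hsum' hpos2 ?_ hC hA
    refine Fin.addCases (fun i m x => ?_) fun i m x => ?_
    · simp only [s, Fin.append_left]
      exact hc i (qs i) (hqs i).1 (hqs i).2 m x
    · refine ⟨fun _ => 1 / (m + 1), fun _ => by positivity, ?_, ?_⟩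
      · simp only [Finset.sum_const, Finset.card_univ, Fintype.card_fin, nsmul_eq_mul]
        rw [mul_one_div, div_le_one (by positivity)]
        linarith
      · simp only [s, Fin.append_right, neg_zero, Real.rpow_zero, RCLike.ofReal_one, one_smul,
          one_mul, le_refl]
  have hset : summingMaps 𝕜 E F p (Fin.append (fun _ : Fin k => (1 : ℝ≥0∞)) ps)
      = summingMaps 𝕜 E F q (Fin.append qs ps) := Set.ext fun A =>
    ⟨fun ⟨C, hC, hA⟩ => ⟨C, hC, up A C hC hA⟩,
      fun ⟨C, hC, hA⟩ => ⟨c' * C, mul_pos hc' hC, down A C hC hA⟩⟩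
  have hnonneg : ∀ (r : ℝ≥0∞) (rs : Fin (k + l) → ℝ≥0∞) (A : ContinuousMultilinearMap 𝕜 E F),
      0 ≤ summingNorm r rs A := fun r rs A => Real.sInf_nonneg fun C hC => hC.1.le
  refine ⟨hset, max 1 c', lt_max_of_lt_left one_pos, fun A hA => ⟨?_, ?_⟩⟩
  · refine (summingNorm_le_mul one_pos hA fun C hC h => ?_).trans
      (mul_le_mul_of_nonneg_right (le_max_left _ _) (hnonneg _ _ A))
    rw [one_mul]
    exact up A C hC h
  · exact (summingNorm_le_mul hc' (hset ▸ hA) fun C hC h => down A C hC h).trans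
      (mul_le_mul_of_nonneg_right (le_max_right _ _) (hnonneg _ _ A))
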